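/- **Corollary 5.3 (Bartlett-type formula).** Let $A\in\mathbb R^{m\times n}$ have rank $m$, let $b\in\mathbb R^m$, and suppose that the polytope $$K_n=\{x\in\mathbb R^n : x_j\ge 0\ (1\le j\le n),\ Ax=b\}$$ is compact and contains a point all of whose coordinates are strictly positive. Let $P_n$ be the uniform distribution on $K_n$, $P_n(E)=H^{n-m}(E\cap K_n)/H^{n-m}(K_n)$, where $H^{n-m}$ is the $(n-m)$-dimensional Hausdorff measure. Let $w=(w_1,\dots,w_n)$ lie in the row span of $A$ with $w_j>0$ for all $j$, and let $$dP_{n,w}(x)=\Big(\prod_{j=1}^n w_j\Big)e^{-\sum_{j=1}^n w_jx_j}\,\mathbf 1_{\mathbb R^n_{\ge0}}(x)\,dx .$$ Thus, under $P_{n,w}$, the coordinates $X_1,\dots,X_n$ are independent and $X_j$ is exponentially distributed with parameter $w_j$. For arbitrary weights $\lambda_1,\dots,\lambda_n\in\mathbb R$ put $S_n=\sum_{j=1}^n\lambda_j\,(X_j-\mathbb E_{P_n}X_j)$. Assume that removing any one column from $A$ does not reduce its rank. Then for every $t\in\mathbb R$ the function $\eta\mapsto\mathbb E_{P_{n,w}}e^{itS_n+i\sum_{l=1}^m\eta_l(A_{l\bullet}X-b_l)}$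 is Lebesgue integrable on $\mathbb R^m$, the integral in the denominator below is nonzero, and $$\mathbb E_{P_n}e^{itS_n}=\frac{\displaystyle\int_{\mathbb R^m}\mathbb E_{P_{n,w}}e^{itS_n+i\sum_{l=1}^m\eta_l(A_{l\bullet}X-b_l)}\,d\eta}{\displaystyle\int_{\mathbb R^m}\mathbb E_{P_{n,w}}e^{i\sum_{l=1}^m\eta_l(A_{l\bullet}X-b_l)}\,d\eta},$$ where $A_{l\bullet}$ denotes the $l$-th row of $A$. -/

import Mathlib

open MeasureTheory ProbabilityTheory

noncomputable section

namespace PolytopeBartlett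

/-- The polytope `{x ∈ ℝⁿ : x ≥ 0, A x = b}`. -/
def polytope {m n : ℕ} (A : Matrix (Fin m) (Fin n) ℝ) (b : Fin m → ℝ) :
    Set (EuclideanSpace ℝ (Fin n)) :=
  {x | (∀ j, 0 ≤ x j) ∧ ∀ l, ∑ j, A l j * x j = b l}

/-- The uniform distribution on the polytope: `E ↦ H (E ∩ K) / H K`, where `H` is the
`(n - m)`-dimensional Hausdorff measure on Euclidean space. -/
def uniformLaw {m n : ℕ} (A : Matrix (Fin m) (Fin n) ℝ) (b : Fin m → ℝ) :
    Measure (EuclideanSpace ℝ (Fin n)) :=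
  (Measure.hausdorffMeasure ((n : ℝ) - (m : ℝ)) (polytope A b))⁻¹ •
    (Measure.hausdorffMeasure ((n : ℝ) - (m : ℝ))).restrict (polytope A b)

/-- The measure with density `(∏ w_j) exp (- ∑ w_j x_j)` on the nonnegative orthant. -/
def expLaw {n : ℕ} (w : Fin n → ℝ) : Measure (EuclideanSpace ℝ (Fin n)) :=
  volume.withDensity
    ({x : EuclideanSpace ℝ (Fin n) | ∀ j, 0 ≤ x j}.indicator
      fun x => ENNReal.ofReal ((∏ j, w j) * Real.exp (-∑ j, w j * x j)))

/-- The linear statistic `S(x) = ∑ c_j (x_j - 𝔼 X_j)` with weights `c`, where the centering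
expectation is taken with respect to the uniform distribution on the polytope. -/
def linStat {m n : ℕ} (A : Matrix (Fin m) (Fin n) ℝ) (b : Fin m → ℝ) (c : Fin n → ℝ)
    (x : EuclideanSpace ℝ (Fin n)) : ℝ :=
  ∑ j, c j * (x j - ∫ y, y j ∂(uniformLaw A b))

/-- `𝔼 exp (i t S + i ∑ η_l (A_l X - b_l))` for `X` distributed according to `expLaw w`. -/
def bartlettIntegrand {m n : ℕ} (A : Matrix (Fin m) (Fin n) ℝ) (b : Fin m → ℝ)
    (c w : Fin n → ℝ) (t : ℝ) (η : EuclideanSpace ℝ (Fin m)) : ℂ :=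
  ∫ x, Complex.exp (Complex.I * t * (linStat A b c x : ℝ) +
    Complex.I * ((∑ l, η l * ((∑ j, A l j * x j) - b l) : ℝ) : ℂ)) ∂(expLaw w)

end PolytopeBartlett

end

/-! Since `w` is a combination of the rows, `∑ w_j x_j = ∑ u_l (A x)_l`, so the exponential density
is constant on the part of the fibre `A x = b` inside the orthant. Conditioning the exponential law
on `A X = b` therefore gives the uniform law on the polytope, and the formula is this conditioning
written by Fourier inversion.

Let `F y` be the integral over the fibre `A x = y` of the density times `exp (i t S)`. Up to a
scaling of the frequency and a phase, the Bartlett integrand is the Fourier transform of `F`, so its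
integral over `η` is a nonzero constant times `F b`, that is, times the Hausdorff integral of `exp
(i t S)` over the polytope. The constant does not depend on `t` and cancels in the quotient; it is
never computed (`exists_integral_fourier_eq_fiber_integral`, `fiber_integral_eq`).

Pointwise inversion at `b` has two analytic requirements. The transform must be integrable: it is a
product of factors `w_j / (w_j - i s_j)`, each in `L^p` only for `p > 1`, and the column condition
leaves just enough room for a Brascamp-Lieb type bound (`integrable_prod_comp_linear`). And `F` must
be continuous at `b`: the strictly positive point makes the discontinuities of the density null in
that fibre, and dominated convergence applies (`continuousAt_fiber_integral`). -/

noncomputable section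

namespace PolytopeBartlett

/-! ### The exponential law as a product measure, and its characteristic function. -/

/-- A product of measures on `ℝ` with integrable densities has the product density. -/
lemma pi_withDensity_ofReal {ι : Type*} [Fintype ι] {g : ι → ℝ → ℝ}
    (hg : ∀ i, Integrable (g i)) (h0 : ∀ i x, 0 ≤ g i x) :
    Measure.pi (fun i => (volume : Measure ℝ).withDensity fun x => ENNReal.ofReal (g i x)) =
      (volume : Measure (ι → ℝ)).withDensity fun x => ENNReal.ofReal (∏ i, g i (x i)) := by
  have : ∀ i, IsFiniteMeasure
      ((volume : Measure ℝ).withDensity fun x => ENNReal.ofReal (g i x)) := fun i =>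
    isFiniteMeasure_withDensity_ofReal (hg i).2
  refine Measure.pi_eq fun s hs => ?_
  rw [withDensity_apply _ (MeasurableSet.univ_pi hs), volume_pi, Measure.restrict_pi_pi,
    ← ofReal_integral_eq_lintegral_ofReal
      (Integrable.fintype_prod (μ := fun i => volume.restrict (s i)) fun i => (hg i).restrict)
      (ae_of_all _ fun x => Finset.prod_nonneg fun i _ => h0 i _),
    integral_fintype_prod_eq_prod (μ := fun i => volume.restrict (s i)) (fun i x => g i x),
    ENNReal.ofReal_prod_of_nonneg fun i _ => integral_nonneg fun x => h0 i x]
  refine Finset.prod_congr rfl fun i _ => ?_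
  rw [withDensity_apply _ (hs i), ofReal_integral_eq_lintegral_ofReal (hg i).restrict
    (ae_of_all _ fun x => h0 i x)]

lemma expMeasure_eq_withDensity (r : ℝ) :
    expMeasure r = volume.withDensity fun x => ENNReal.ofReal (exponentialPDFReal r x) := rfl

lemma exponentialPDFReal_eq_ite (r x : ℝ) :
    exponentialPDFReal r x = if 0 ≤ x then r * Real.exp (-(r * x)) else 0 := by
  simp [exponentialPDFReal, gammaPDFReal]

lemma integrable_exponentialPDFReal {r : ℝ} (hr : 0 < r) :
    Integrable (exponentialPDFReal r) := by
  refine ⟨(stronglyMeasurable_exponentialPDFReal r).aestronglyMeasurable, ?_⟩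
  rw [hasFiniteIntegral_iff_ofReal (ae_of_all _ fun x => exponentialPDFReal_nonneg hr x)]
  exact (lintegral_exponentialPDF_eq_one hr).trans_lt ENNReal.one_lt_top

/-- Under `expLaw w` the coordinates are independent exponential variables. -/
lemma expLaw_eq_map_pi {n : ℕ} {w : Fin n → ℝ} (hw : ∀ j, 0 < w j) :
    expLaw w = (Measure.pi fun j => expMeasure (w j)).map
      (MeasurableEquiv.toLp 2 (Fin n → ℝ)) := by
  simp_rw [expMeasure_eq_withDensity]
  rw [pi_withDensity_ofReal (fun j => integrable_exponentialPDFReal (hw j))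
    (fun j x => exponentialPDFReal_nonneg (hw j) x)]
  refine Measure.ext fun s hs => ?_
  rw [MeasurableEquiv.map_apply, expLaw, withDensity_apply _ hs,
    withDensity_apply _ ((MeasurableEquiv.toLp 2 (Fin n → ℝ)).measurable hs),
    ← (PiLp.volume_preserving_toLp (Fin n)).setLIntegral_comp_preimage_emb
      (MeasurableEquiv.toLp 2 (Fin n → ℝ)).measurableEmbedding]
  refine lintegral_congr fun x => ?_
  by_cases hx : ∀ j, 0 ≤ x j
  · rw [Set.indicator_of_mem (by simpa using hx)]
    simp [exponentialPDFReal_eq_ite, hx, Finset.prod_mul_distrib, ← Real.exp_sum]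
  · rw [Set.indicator_of_notMem (by simpa using hx)]
    obtain ⟨j, hj⟩ := not_forall.1 hx
    rw [Finset.prod_eq_zero (Finset.mem_univ j) (by simp [exponentialPDFReal_eq_ite, hj])]
    simp

lemma isProbabilityMeasure_expLaw {n : ℕ} {w : Fin n → ℝ} (hw : ∀ j, 0 < w j) :
    IsProbabilityMeasure (expLaw w) := by
  have := fun j => isProbabilityMeasure_expMeasure (hw j)
  rw [expLaw_eq_map_pi hw]
  exact Measure.isProbabilityMeasure_map (MeasurableEquiv.measurable _).aemeasurable

lemma map_eval_expLaw {n : ℕ} {w : Fin n → ℝ} (hw : ∀ j, 0 < w j) (j : Fin n) :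
    (expLaw w).map (fun x : EuclideanSpace ℝ (Fin n) => x j) = expMeasure (w j) := by
  have := fun j => isProbabilityMeasure_expMeasure (hw j)
  rw [expLaw_eq_map_pi hw, Measure.map_map (by fun_prop) (MeasurableEquiv.measurable _)]
  exact (measurePreserving_eval (fun j => expMeasure (w j)) j).map_eq

lemma iIndepFun_expLaw {n : ℕ} {w : Fin n → ℝ} (hw : ∀ j, 0 < w j) :
    iIndepFun (fun (j : Fin n) (x : EuclideanSpace ℝ (Fin n)) => x j) (expLaw w) := by
  have := isProbabilityMeasure_expLaw hw
  rw [iIndepFun_iff_map_fun_eq_pi_map (fun j => by fun_prop)]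
  simp_rw [map_eval_expLaw hw]
  rw [expLaw_eq_map_pi hw, Measure.map_map (by fun_prop) (MeasurableEquiv.measurable _)]
  exact Measure.map_id

lemma integral_cexp_expMeasure {r : ℝ} (hr : 0 < r) (s : ℝ) :
    ∫ x, Complex.exp (Complex.I * s * x) ∂(expMeasure r) = r / (r - Complex.I * s) := by
  rw [expMeasure_eq_withDensity,
    integral_withDensity_eq_integral_toReal_smul (by fun_prop) (by simp)]
  have h : ∀ x : ℝ, (ENNReal.ofReal (exponentialPDFReal r x)).toReal •
      Complex.exp (Complex.I * s * x) =
      (Set.Ici 0).indicator (fun x : ℝ => (r : ℂ) * Complex.exp ((Complex.I * s - r) * x)) x := by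
    intro x
    rw [ENNReal.toReal_ofReal (exponentialPDFReal_nonneg hr x), exponentialPDFReal_eq_ite]
    by_cases hx : 0 ≤ x
    · simp only [hx, if_true, Set.indicator_of_mem (Set.mem_Ici.2 hx), Complex.real_smul]
      push_cast
      rw [mul_assoc, ← Complex.exp_add]
      ring_nf
    · simp [hx]
  have hre : (Complex.I * s - r).re < 0 := by simpa using hr
  simp_rw [h]
  rw [integral_indicator measurableSet_Ici, integral_Ici_eq_integral_Ioi, integral_const_mul,
    integral_exp_mul_complex_Ioi hre]
  have h1 : Complex.I * s - r ≠ 0 := fun h => by simp [h] at hre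
  have h2 : (r : ℂ) - Complex.I * s ≠ 0 := fun h => h1 (by linear_combination -h)
  simp only [Complex.ofReal_zero, mul_zero, Complex.exp_zero]
  rw [← mul_div_assoc, div_eq_div_iff h1 h2]
  ring

/-- The characteristic function of `expLaw w`. -/
lemma integral_cexp_expLaw {n : ℕ} {w : Fin n → ℝ} (hw : ∀ j, 0 < w j) (s : Fin n → ℝ) :
    ∫ x, Complex.exp (Complex.I * (∑ j, s j * x j : ℝ)) ∂(expLaw w) =
      ∏ j, ((w j : ℂ) / (w j - Complex.I * s j)) := by
  have := fun j => isProbabilityMeasure_expMeasure (hw j)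
  rw [expLaw_eq_map_pi hw, integral_map_equiv]
  simp_rw [← integral_cexp_expMeasure (hw _)]
  rw [← integral_fintype_prod_eq_prod (μ := fun j => expMeasure (w j))
    (fun j (x : ℝ) => Complex.exp (Complex.I * s j * x))]
  refine integral_congr_ae (ae_of_all _ fun x => ?_)
  simp [← Complex.exp_sum, Finset.mul_sum, mul_assoc]

/-! ### Integrability of the Bartlett integrand. -/

open Matrix in
/-- If deleting a column keeps the full row rank, some invertible square submatrix avoids that
column. -/
lemma exists_det_submatrix_ne_zero {m n : ℕ} {A : Matrix (Fin m) (Fin n) ℝ} {j : Fin n}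
    (h : (A.submatrix id (fun k : {k : Fin n // k ≠ j} => (k : Fin n))).rank = m) :
    ∃ e : Fin m → Fin n, Function.Injective e ∧ (∀ l, e l ≠ j) ∧
      (A.submatrix id e).det ≠ 0 := by
  set M := A.submatrix id (fun k : {k : Fin n // k ≠ j} => (k : Fin n)) with hM
  obtain ⟨κ, a, ha, hsp, hli⟩ := exists_linearIndependent' ℝ M.col
  have : Finite κ := Finite.of_injective a ha
  have := Fintype.ofFinite κ
  have hcard : Fintype.card κ = m := by
    rw [← finrank_span_eq_card hli, hsp, ← rank_eq_finrank_span_cols, h]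
  let E : Fin m ≃ κ := (Fintype.equivFinOfCardEq hcard).symm
  refine ⟨fun l => a (E l), fun x y hxy => E.injective (ha (Subtype.ext hxy)),
    fun l => (a (E l)).2, ?_⟩
  rw [← isUnit_iff_ne_zero, ← isUnit_iff_isUnit_det, ← linearIndependent_cols_iff_isUnit]
  exact hli.comp E E.injective

/-- Precomposition of an integrable function with an invertible matrix is integrable. -/
lemma integrable_comp_mulVec {ι : Type*} [Fintype ι] [DecidableEq ι] {M : Matrix ι ι ℝ}
    (hM : M.det ≠ 0) {G : (ι → ℝ) → ℝ} (hG : Integrable G) :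
    Integrable fun x => G (M.mulVec x) := by
  have h : Integrable G ((volume : Measure (ι → ℝ)).map (Matrix.toLin' M)) := by
    rw [Real.map_matrix_volume_pi_eq_smul_volume_pi hM]
    exact hG.smul_measure ENNReal.ofReal_ne_top
  exact h.comp_measurable (by fun_prop)

/-- The combinatorial inequality behind `integrable_prod_comp_linear`: if the `k`-th set of
indices avoids `k`, then a product of numbers in `[0, 1]` is bounded by an average of partial
products with an exponent slightly larger than `1`. -/
lemma prod_le_sum_prod_rpow {ι κ : Type*} [Fintype ι] [Fintype κ] [Nonempty ι] {e : ι → κ → ι}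
    (he : ∀ k, Function.Injective (e k)) (hne : ∀ k l, e k l ≠ k) {y : ι → ℝ}
    (h0 : ∀ j, 0 ≤ y j) (h1 : ∀ j, y j ≤ 1) :
    ∏ j, y j ≤ ∑ k, (Fintype.card ι : ℝ)⁻¹ *
      ∏ l, y (e k l) ^ (1 + (Fintype.card ι : ℝ)⁻¹) := by
  classical
  set N : ℝ := (Fintype.card ι : ℝ) with hN
  have hN0 : 0 < N := by rw [hN]; exact_mod_cast Fintype.card_pos
  have hN1 : 1 ≤ N := by rw [hN]; exact_mod_cast Fintype.card_pos
  -- The outer factor `N⁻¹` is the weight used in AM-GM below. The exponent `1 + N⁻¹` exceeds `1`,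
  -- yet `q * (N - 1) = 1 - N⁻²` stays below `1`.
  set q : ℝ := (1 + N⁻¹) * N⁻¹ with hq
  have hq0 : 0 ≤ q := by positivity
  have hqN : q * (N - 1) ≤ 1 := by
    have : q * (N - 1) = 1 - (N⁻¹) ^ 2 := by rw [hq]; field_simp; ring
    nlinarith [sq_nonneg N⁻¹]
  -- The `j`-th set avoids `j`, so at most `N - 1` of the factors differ from `1`.
  have key : ∀ j, y j ≤ ∏ k, if j ∈ Set.range (e k) then y j ^ q else 1 := by
    intro j
    rw [← Finset.mul_prod_erase _ _ (Finset.mem_univ j), if_neg (by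
      rintro ⟨l, hl⟩; exact hne j l hl), one_mul]
    calc y j ≤ y j ^ (q * (N - 1)) := by
          simpa using Real.rpow_le_rpow_of_exponent_ge' (h0 j) (h1 j)
            (mul_nonneg hq0 (by linarith)) hqN
      _ = ∏ k ∈ Finset.univ.erase j, y j ^ q := by
          rw [Finset.prod_const, Finset.card_erase_of_mem (Finset.mem_univ j), Finset.card_univ,
            Real.rpow_mul (h0 j), ← Real.rpow_natCast, Nat.cast_sub Fintype.card_pos, Nat.cast_one]
      _ ≤ _ := by
          refine Finset.prod_le_prod (fun k _ => Real.rpow_nonneg (h0 j) _) fun k _ => ?_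
          split_ifs
          · exact le_rfl
          · exact Real.rpow_le_one (h0 j) (h1 j) hq0
  calc ∏ j, y j ≤ ∏ j, ∏ k, (if j ∈ Set.range (e k) then y j ^ q else 1) :=
        Finset.prod_le_prod (fun j _ => h0 j) fun j _ => key j
    _ = ∏ k, ∏ l, y (e k l) ^ q := by
        rw [Finset.prod_comm]
        refine Finset.prod_congr rfl fun k _ => ?_
        rw [← Finset.prod_image (s := Finset.univ) (g := e k) (f := fun j => y j ^ q)
          (he k).injOn, Finset.prod_ite, Finset.prod_const_one, mul_one]
        congr 1
        ext j
        simp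
    _ = ∏ k, (∏ l, y (e k l) ^ (1 + N⁻¹)) ^ N⁻¹ := by
        refine Finset.prod_congr rfl fun k _ => ?_
        rw [← Real.finsetProd_rpow _ _ fun l _ => Real.rpow_nonneg (h0 _) _]
        simp_rw [← Real.rpow_mul (h0 _), hq]
    _ ≤ _ := Real.geom_mean_le_arith_mean_weighted _ _ _ (fun _ _ => by positivity)
        (by simp [← hN, hN0.ne'])
        fun k _ => Finset.prod_nonneg fun l _ => Real.rpow_nonneg (h0 _) _

/-- A Brascamp-Lieb type integrability criterion for products of functions of linear forms. -/
lemma integrable_prod_comp_linear {m n : ℕ} {A : Matrix (Fin m) (Fin n) ℝ} [NeZero n]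
    (hcol : ∀ j : Fin n,
      (A.submatrix id (fun k : {k : Fin n // k ≠ j} => (k : Fin n))).rank = m)
    {f : Fin n → ℝ → ℝ} (hf : ∀ j, Continuous (f j)) (h0 : ∀ j s, 0 ≤ f j s)
    (h1 : ∀ j s, f j s ≤ 1)
    (hint : ∀ j, Integrable fun s => f j s ^ (1 + (n : ℝ)⁻¹)) (τ : Fin n → ℝ) :
    Integrable fun η : Fin m → ℝ => ∏ j, f j (τ j + ∑ l, η l * A l j) := by
  choose e he hne hdet using fun j => exists_det_submatrix_ne_zero (hcol j)
  have hbound : Integrable fun η : Fin m → ℝ => ∑ k, (n : ℝ)⁻¹ *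
      ∏ l, f (e k l) (τ (e k l) + ∑ i, η i * A i (e k l)) ^ (1 + (n : ℝ)⁻¹) := by
    refine integrable_finsetSum _ fun k _ => Integrable.const_mul ?_ _
    have hG : Integrable fun v : Fin m → ℝ =>
        ∏ l, f (e k l) (τ (e k l) + v l) ^ (1 + (n : ℝ)⁻¹) :=
      Integrable.fintype_prod
        (f := fun l s => f (e k l) (τ (e k l) + s) ^ (1 + (n : ℝ)⁻¹))
        fun l => (hint (e k l)).comp_add_left (τ (e k l))
    have := integrable_comp_mulVec (M := (A.submatrix id (e k)).transpose)
      (by rw [Matrix.det_transpose]; exact hdet k) hG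
    simpa [Matrix.mulVec, dotProduct, mul_comm] using this
  refine hbound.mono' (Continuous.aestronglyMeasurable (by fun_prop)) (ae_of_all _ fun η => ?_)
  rw [Real.norm_of_nonneg (Finset.prod_nonneg fun j _ => h0 _ _)]
  simpa using prod_le_sum_prod_rpow he hne (y := fun j => f j (τ j + ∑ l, η l * A l j))
    (fun j => h0 _ _) fun j => h1 _ _

lemma norm_div_sub_I_mul {r : ℝ} (hr : 0 < r) (s : ℝ) :
    ‖(r : ℂ) / (r - Complex.I * s)‖ = (1 + ‖r⁻¹ * s‖ ^ 2) ^ (-(1 / 2 : ℝ)) := by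
  have h : ‖(r : ℂ) - Complex.I * s‖ = Real.sqrt (r ^ 2 + s ^ 2) := by
    rw [Complex.norm_def, Complex.normSq_apply]
    simp [sq]
  rw [norm_div, h, Complex.norm_real, Real.norm_of_nonneg hr.le, Real.rpow_neg (by positivity),
    ← Real.sqrt_eq_rpow, Real.norm_eq_abs, sq_abs]
  have : r ^ 2 + s ^ 2 = r ^ 2 * (1 + (r⁻¹ * s) ^ 2) := by field_simp
  rw [this, Real.sqrt_mul (by positivity), Real.sqrt_sq hr.le]
  field_simp

/-- The modulus decays like `1 / |s|`, so every exponent above `1` suffices, while `1` itself does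
not. -/
lemma integrable_norm_div_sub_rpow {r p : ℝ} (hr : 0 < r) (hp : 1 < p) :
    Integrable fun s : ℝ => ‖(r : ℂ) / (r - Complex.I * s)‖ ^ p := by
  have h : Integrable fun s : ℝ => (1 + ‖s‖ ^ 2) ^ (-p / 2) :=
    integrable_rpow_neg_one_add_norm_sq (by simpa using hp)
  refine (h.comp_mul_left' (inv_ne_zero hr.ne')).congr (ae_of_all _ fun s => ?_)
  simp only [norm_div_sub_I_mul hr]
  rw [← Real.rpow_mul (by positivity)]
  ring_nf

/-- The Bartlett integrand as an explicit product. -/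
lemma bartlettIntegrand_eq {m n : ℕ} (A : Matrix (Fin m) (Fin n) ℝ) (b : Fin m → ℝ)
    (c : Fin n → ℝ) {w : Fin n → ℝ} (hw : ∀ j, 0 < w j) (t : ℝ) (η : EuclideanSpace ℝ (Fin m)) :
    bartlettIntegrand A b c w t η =
      Complex.exp (Complex.I * ((-(t * ∑ j, c j * ∫ y, y j ∂(uniformLaw A b)) -
        ∑ l, η l * b l : ℝ) : ℂ)) *
      ∏ j, ((w j : ℂ) / (w j - Complex.I * (t * c j + ∑ l, η l * A l j : ℝ))) := by
  rw [bartlettIntegrand, ← integral_cexp_expLaw hw, ← integral_const_mul]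
  refine integral_congr_ae (ae_of_all _ fun x => ?_)
  have h : (∑ l, η l * ((∑ j, A l j * x j) - b l)) =
      ∑ j, (∑ l, η l * A l j) * x j - ∑ l, η l * b l := by
    simp_rw [mul_sub, Finset.sum_sub_distrib, Finset.mul_sum, Finset.sum_mul]
    rw [Finset.sum_comm]
    simp_rw [mul_assoc]
  have h2 : t * linStat A b c x = ∑ j, t * c j * x j -
      t * ∑ j, c j * ∫ y, y j ∂(uniformLaw A b) := by
    simp_rw [linStat, mul_sub, Finset.sum_sub_distrib, mul_sub, Finset.mul_sum, mul_assoc]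
  simp only
  rw [← Complex.exp_add, h, mul_assoc, ← Complex.ofReal_mul, h2, ← mul_add, ← mul_add,
    ← Complex.ofReal_add, ← Complex.ofReal_add]
  simp_rw [add_mul, Finset.sum_add_distrib]
  congr 3
  ring

lemma integrable_bartlettIntegrand {m n : ℕ} {A : Matrix (Fin m) (Fin n) ℝ} (b : Fin m → ℝ)
    (hrank : A.rank = m)
    (hcol : ∀ j : Fin n,
      (A.submatrix id (fun k : {k : Fin n // k ≠ j} => (k : Fin n))).rank = m)
    {w : Fin n → ℝ} (hw : ∀ j, 0 < w j) (c : Fin n → ℝ) (t : ℝ) :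
    Integrable (bartlettIntegrand A b c w t) := by
  have hne : ∀ j (s : ℝ), (w j : ℂ) - Complex.I * s ≠ 0 := fun j s h => by
    have := congrArg Complex.re h
    simp [(hw j).ne'] at this
  have hnorm : Integrable fun η : EuclideanSpace ℝ (Fin m) =>
      ∏ j, ‖(w j : ℂ) / (w j - Complex.I * (t * c j + ∑ l, η l * A l j : ℝ))‖ := by
    rw [← (PiLp.volume_preserving_toLp (Fin m)).integrable_comp_emb
      (MeasurableEquiv.toLp 2 (Fin m → ℝ)).measurableEmbedding]
    -- The exponent `1 + 1 / n` needs `n > 0`; if `n = 0` then `m = 0` and the integral is over a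
    -- point.
    rcases Nat.eq_zero_or_pos n with rfl | hn
    · obtain rfl : m = 0 := by have := A.rank_le_width; omega
      have : IsFiniteMeasure (volume : Measure (Fin 0 → ℝ)) := by
        rw [Measure.volume_pi_eq_dirac]; infer_instance
      simp [Function.comp_def]
    have : NeZero n := ⟨hn.ne'⟩
    refine integrable_prod_comp_linear hcol
      (f := fun j s => ‖(w j : ℂ) / (w j - Complex.I * s)‖) (fun j => ?_)
      (fun j s => norm_nonneg _) (fun j s => ?_) (fun j => ?_) fun j => t * c j
    · exact (continuous_const.div (by fun_prop) (hne j)).norm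
    · rw [norm_div_sub_I_mul (hw j)]
      exact Real.rpow_le_one_of_one_le_of_nonpos (by simp; positivity) (by norm_num)
    · exact integrable_norm_div_sub_rpow (hw j) (by simpa using hn)
  refine hnorm.mono' ?_ (ae_of_all _ fun η => ?_)
  · rw [show bartlettIntegrand A b c w t = _ from funext fun η => bartlettIntegrand_eq A b c hw t η]
    refine Continuous.aestronglyMeasurable (.mul (by fun_prop) (continuous_finsetProd _ fun j _ =>
      continuous_const.div (by fun_prop) fun η => hne j _))
  · rw [bartlettIntegrand_eq A b c hw, norm_mul, mul_comm Complex.I, Complex.norm_exp_ofReal_mul_I,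
      one_mul, norm_prod]

/-! ### Fourier inversion along the fibres of a linear map. -/

section FiberIntegral

open scoped RealInnerProductSpace FourierTransform

variable {E G : Type*} [NormedAddCommGroup E] [InnerProductSpace ℝ E] [FiniteDimensional ℝ E]
  [NormedAddCommGroup G] [InnerProductSpace ℝ G] [FiniteDimensional ℝ G]

/-- A linear map with a right inverse splits its domain as codomain times kernel. -/
def prodKerEquiv (T : E →ₗ[ℝ] G) (L : G →ₗ[ℝ] E) (h : ∀ y, T (L y) = y) :
    (G × LinearMap.ker T) ≃L[ℝ] E :=
  LinearEquiv.toContinuousLinearEquiv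
    { toFun := fun p => L p.1 + p.2
      map_add' := fun p q => by simp; abel
      map_smul' := fun r p => by simp
      invFun := fun x => (T x, ⟨x - L (T x), by simp [h]⟩)
      left_inv := fun p => by
        have hp : T (p.2 : E) = 0 := p.2.2
        ext <;> simp [h, hp]
      right_inv := fun x => by simp }

lemma prodKerEquiv_apply (T : E →ₗ[ℝ] G) (L : G →ₗ[ℝ] E) (h : ∀ y, T (L y) = y)
    (p : G × LinearMap.ker T) : prodKerEquiv T L h p = L p.1 + p.2 := rfl

variable [MeasurableSpace E] [BorelSpace E] [MeasurableSpace G] [BorelSpace G]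

/-- Uniqueness of Haar measure replaces a Jacobian computation; only `κ ≠ 0` matters later. -/
lemma exists_measure_eq_smul_map_prodKerEquiv {T : E →ₗ[ℝ] G} {L : G →ₗ[ℝ] E}
    (h : ∀ y, T (L y) = y) (μ : Measure E) [μ.IsAddHaarMeasure]
    (ν : Measure (LinearMap.ker T)) [ν.IsAddHaarMeasure] :
    ∃ κ : NNReal, κ ≠ 0 ∧
      μ = κ • ((volume : Measure G).prod ν).map (prodKerEquiv T L h) := by
  have : (((volume : Measure G).prod ν).map (prodKerEquiv T L h)).IsAddHaarMeasure :=
    (prodKerEquiv T L h).isAddHaarMeasure_map _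
  exact ⟨_, (Measure.addHaarScalarFactor_pos_of_isAddHaarMeasure _ _).ne',
    Measure.isAddLeftInvariant_eq_smul μ _⟩

/-- Fourier inversion for the pushforward of a density under a linear map, evaluated at a point of
continuity of the fibre integrals. -/
lemma exists_integral_fourier_eq_fiber_integral {T : E →ₗ[ℝ] G} {L : G →ₗ[ℝ] E}
    (h : ∀ y, T (L y) = y) (μ : Measure E) [μ.IsAddHaarMeasure]
    (ν : Measure (LinearMap.ker T)) [ν.IsAddHaarMeasure] :
    ∃ K : ℂ, K ≠ 0 ∧ ∀ (b : G) (g : E → ℂ), Integrable g μ →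
      ContinuousAt (fun y => ∫ z, g (L y + z) ∂ν) b →
      Integrable (fun η : G => ∫ x, g x * Complex.exp (Complex.I * (⟪η, T x - b⟫ : ℝ)) ∂μ) →
      ∫ η : G, ∫ x, g x * Complex.exp (Complex.I * (⟪η, T x - b⟫ : ℝ)) ∂μ =
        K * ∫ z, g (L b + z) ∂ν := by
  obtain ⟨κ, hκ, hμ⟩ := exists_measure_eq_smul_map_prodKerEquiv h μ ν
  have hκ' : (κ : ℂ) ≠ 0 := by exact_mod_cast hκ
  set d := Module.finrank ℝ G with hd
  set R : ℝ := |((-(2 * Real.pi)) ^ d)⁻¹| with hR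
  have hR0 : R ≠ 0 := by simp [hR, Real.pi_ne_zero]
  have hR0' : (R : ℂ) ≠ 0 := by exact_mod_cast hR0
  refine ⟨κ * (R : ℂ)⁻¹, mul_ne_zero hκ' (inv_ne_zero hR0'), fun b g hg hcont hint => ?_⟩
  set Φ : G → ℂ := fun η => ∫ x, g x * Complex.exp (Complex.I * (⟪η, T x - b⟫ : ℝ)) ∂μ with hΦ
  set F : G → ℂ := fun y => ∫ z, g (L y + z) ∂ν with hF
  set Ψ := prodKerEquiv T L h with hΨ
  have hΨm : MeasurableEmbedding Ψ := Ψ.toHomeomorph.measurableEmbedding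
  have hprod : Integrable (fun p : G × LinearMap.ker T => g (L p.1 + p.2))
      ((volume : Measure G).prod ν) := by
    rw [hμ] at hg
    have := (integrable_smul_measure (c := (κ : ENNReal)) (by simpa using hκ) (by simp)).1 hg
    exact hΨm.integrable_map_iff.1 this
  have hFint : Integrable F := hprod.integral_prod_left
  have hTz : ∀ z : LinearMap.ker T, T (z : E) = 0 := fun z => z.2
  -- The character depends on `x` only through `T x`, so it is constant along the kernel and Fubini
  -- leaves the fibre integral.
  have hΦF : ∀ η, Φ η = κ * ∫ y, F y * Complex.exp (Complex.I * (⟪η, y - b⟫ : ℝ)) := by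
    intro η
    simp only [hΦ]
    rw [hμ, integral_smul_nnreal_measure, hΨm.integral_map]
    simp only [hΨ, prodKerEquiv_apply, map_add, h, hTz, add_zero]
    rw [integral_prod]
    · simp only [integral_mul_const, hF]
      rfl
    · refine hprod.mul_bdd (c := 1) (Continuous.aestronglyMeasurable (by fun_prop))
        (ae_of_all _ fun p => ?_)
      rw [mul_comm, Complex.norm_exp_ofReal_mul_I]
  have hFour : ∀ ξ, 𝓕 F ξ = (κ : ℂ)⁻¹ * (Complex.exp (-(2 * Real.pi * ⟪ξ, b⟫ : ℝ) * Complex.I) *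
      Φ (-(2 * Real.pi) • ξ)) := by
    intro ξ
    rw [hΦF, mul_left_comm, inv_mul_cancel_left₀ hκ', Real.fourier_eq', ← integral_const_mul]
    refine integral_congr_ae (ae_of_all _ fun y => ?_)
    simp only [smul_eq_mul]
    rw [mul_left_comm, ← Complex.exp_add, mul_comm]
    congr 2
    rw [inner_smul_left, inner_sub_right, real_inner_comm y ξ]
    push_cast
    simp
    ring
  have hFourInt : Integrable (𝓕 F) := by
    rw [funext hFour]
    refine Integrable.const_mul (Integrable.bdd_mul (c := 1) ?_
      (Continuous.aestronglyMeasurable (by fun_prop)) (ae_of_all _ fun ξ => ?_)) _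
    · exact hint.comp_smul (by simp [Real.pi_ne_zero])
    · rw [← Complex.ofReal_neg, Complex.norm_exp_ofReal_mul_I]
  have hinv := hFint.fourierInv_fourier_eq hFourInt hcont
  rw [Real.fourierInv_eq'] at hinv
  -- The phase from centring at `b` is inverse to the one in the inversion formula at `b`.
  have : ∀ ξ, Complex.exp ((2 * Real.pi * ⟪ξ, b⟫ : ℝ) * Complex.I) • 𝓕 F ξ =
      (κ : ℂ)⁻¹ * Φ (-(2 * Real.pi) • ξ) := by
    intro ξ
    rw [hFour, smul_eq_mul, mul_left_comm, ← mul_assoc (Complex.exp _), ← Complex.exp_add]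
    simp
  simp_rw [this] at hinv
  rw [integral_const_mul, Measure.integral_comp_smul, ← hd, ← hR, Complex.real_smul] at hinv
  change _ = _ * F b
  rw [← hinv]
  field_simp

end FiberIntegral

/-! ### The exponential density and continuity of its fibre integrals. -/

open scoped Topology

/-- The density of `expLaw w`. -/
def expDensity {n : ℕ} (w : Fin n → ℝ) : EuclideanSpace ℝ (Fin n) → ℝ :=
  {x : EuclideanSpace ℝ (Fin n) | ∀ j, 0 ≤ x j}.indicator
    fun x => (∏ j, w j) * Real.exp (-∑ j, w j * x j)

lemma isClosed_orthant {n : ℕ} : IsClosed {x : EuclideanSpace ℝ (Fin n) | ∀ j, 0 ≤ x j} := by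
  simp only [Set.ofPred_forall]
  exact isClosed_iInter fun j => isClosed_le continuous_const (by fun_prop)

lemma expDensity_of_nonneg {n : ℕ} (w : Fin n → ℝ) {x : EuclideanSpace ℝ (Fin n)}
    (hx : ∀ j, 0 ≤ x j) : expDensity w x = (∏ j, w j) * Real.exp (-∑ j, w j * x j) :=
  Set.indicator_of_mem (s := {x : EuclideanSpace ℝ (Fin n) | ∀ j, 0 ≤ x j}) hx _

lemma expDensity_of_not_nonneg {n : ℕ} (w : Fin n → ℝ) {x : EuclideanSpace ℝ (Fin n)}
    (hx : ¬ ∀ j, 0 ≤ x j) : expDensity w x = 0 :=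
  Set.indicator_of_notMem (s := {x : EuclideanSpace ℝ (Fin n) | ∀ j, 0 ≤ x j}) hx _

lemma measurable_expDensity {n : ℕ} (w : Fin n → ℝ) : Measurable (expDensity w) :=
  Measurable.indicator (by fun_prop) isClosed_orthant.measurableSet

lemma expDensity_nonneg {n : ℕ} {w : Fin n → ℝ} (hw : ∀ j, 0 < w j)
    (x : EuclideanSpace ℝ (Fin n)) : 0 ≤ expDensity w x :=
  Set.indicator_nonneg (fun _ _ => mul_nonneg (Finset.prod_nonneg fun j _ => (hw j).le)
    (Real.exp_nonneg _)) x

lemma expDensity_le {n : ℕ} {w : Fin n → ℝ} (hw : ∀ j, 0 < w j)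
    (x : EuclideanSpace ℝ (Fin n)) : expDensity w x ≤ ∏ j, w j := by
  have hW : 0 ≤ ∏ j, w j := Finset.prod_nonneg fun j _ => (hw j).le
  by_cases hx : ∀ j, 0 ≤ x j
  · rw [expDensity_of_nonneg w hx]
    refine mul_le_of_le_one_right hW (Real.exp_le_one_iff.2 (neg_nonpos.2 ?_))
    exact Finset.sum_nonneg fun j _ => mul_nonneg (hw j).le (hx j)
  · rwa [expDensity_of_not_nonneg w hx]

lemma expLaw_eq_withDensity {n : ℕ} (w : Fin n → ℝ) :
    expLaw w = volume.withDensity fun x => ENNReal.ofReal (expDensity w x) := by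
  rw [expLaw]
  congr 1
  ext x
  by_cases hx : ∀ j, 0 ≤ x j
  · rw [expDensity_of_nonneg w hx, Set.indicator_of_mem (by exact hx)]
  · rw [expDensity_of_not_nonneg w hx, Set.indicator_of_notMem (by exact hx), ENNReal.ofReal_zero]

lemma integral_expLaw {n : ℕ} {w : Fin n → ℝ} (hw : ∀ j, 0 < w j)
    (f : EuclideanSpace ℝ (Fin n) → ℂ) :
    ∫ x, f x ∂(expLaw w) = ∫ x, (expDensity w x : ℂ) * f x := by
  rw [expLaw_eq_withDensity, integral_withDensity_eq_integral_toReal_smul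
    (measurable_expDensity w).ennreal_ofReal (by simp)]
  simp_rw [ENNReal.toReal_ofReal (expDensity_nonneg hw _), Complex.real_smul]

lemma integrable_expDensity_mul {n : ℕ} {w : Fin n → ℝ} (hw : ∀ j, 0 < w j)
    {f : EuclideanSpace ℝ (Fin n) → ℂ} (hf : Continuous f) (hf1 : ∀ x, ‖f x‖ ≤ 1) :
    Integrable fun x => (expDensity w x : ℂ) * f x := by
  have := isProbabilityMeasure_expLaw hw
  have h : Integrable f (expLaw w) :=
    Integrable.of_bound hf.aestronglyMeasurable 1 (ae_of_all _ hf1)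
  rw [expLaw_eq_withDensity, integrable_withDensity_iff_integrable_smul'
    (measurable_expDensity w).ennreal_ofReal (by simp)] at h
  simpa only [ENNReal.toReal_ofReal (expDensity_nonneg hw _), Complex.real_smul] using h

lemma continuousAt_expDensity {n : ℕ} (w : Fin n → ℝ) {x : EuclideanSpace ℝ (Fin n)}
    (hx : ∀ j, x j ≠ 0) : ContinuousAt (expDensity w) x := by
  have hev : ∀ j, ∀ᶠ y : EuclideanSpace ℝ (Fin n) in 𝓝 x, (0 ≤ y j ↔ 0 ≤ x j) := by
    intro j
    have hc : Filter.Tendsto (fun y : EuclideanSpace ℝ (Fin n) => y j) (𝓝 x) (𝓝 (x j)) :=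
      (show Continuous fun y : EuclideanSpace ℝ (Fin n) => y j by fun_prop).continuousAt
    rcases (hx j).lt_or_gt with h | h
    · filter_upwards [hc.eventually (gt_mem_nhds h)] with y hy
      simp [hy.not_ge, h.not_ge]
    · filter_upwards [hc.eventually (lt_mem_nhds h)] with y hy
      simp [hy.le, h.le]
  have hall := Filter.eventually_all.2 hev
  by_cases h : ∀ j, 0 ≤ x j
  · refine ContinuousAt.congr (f := fun x => (∏ j, w j) * Real.exp (-∑ j, w j * x j))
      (by fun_prop) ?_
    filter_upwards [hall] with y hy
    rw [expDensity_of_nonneg w fun j => (hy j).2 (h j)]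
  · refine ContinuousAt.congr (f := fun _ => 0) continuousAt_const ?_
    filter_upwards [hall] with y hy
    rw [expDensity_of_not_nonneg w fun h' => h fun j => (hy j).1 (h' j)]

/-- A point of the orthant on which a positive functional is bounded has bounded norm. -/
lemma norm_le_of_sum_mul_le {n : ℕ} {w : Fin n → ℝ} (hw : ∀ j, 0 < w j) {C : ℝ}
    {x : EuclideanSpace ℝ (Fin n)} (hx : ∀ j, 0 ≤ x j) (hC : ∑ j, w j * x j ≤ C) :
    ‖x‖ ≤ Real.sqrt (∑ j, (C / w j) ^ 2) := by
  rw [EuclideanSpace.norm_eq]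
  refine Real.sqrt_le_sqrt (Finset.sum_le_sum fun j _ => ?_)
  rw [Real.norm_of_nonneg (hx j)]
  refine pow_le_pow_left₀ (hx j) ((le_div_iff₀' (hw j)).2 (le_trans ?_ hC)) 2
  exact Finset.single_le_sum (f := fun j => w j * x j)
    (fun i _ => mul_nonneg (hw i).le (hx i)) (Finset.mem_univ j)

section Fiber

variable {m n : ℕ} {T : EuclideanSpace ℝ (Fin n) →ₗ[ℝ] EuclideanSpace ℝ (Fin m)}
  {L : EuclideanSpace ℝ (Fin m) →ₗ[ℝ] EuclideanSpace ℝ (Fin n)}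
  (ν : Measure (LinearMap.ker T)) [ν.IsAddHaarMeasure]

/-- Coordinate hyperplanes are null in a translate of the kernel containing a positive point. -/
lemma ae_forall_add_apply_ne_zero {p : EuclideanSpace ℝ (Fin n)} {z₀ : LinearMap.ker T}
    (hz₀ : ∀ j, 0 < (p + z₀ : EuclideanSpace ℝ (Fin n)) j) :
    ∀ᵐ (z : LinearMap.ker T) ∂ν, ∀ j, (p + z : EuclideanSpace ℝ (Fin n)) j ≠ 0 := by
  refine ae_all_iff.2 fun j => ?_
  let φ : LinearMap.ker T →ₗ[ℝ] ℝ :=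
    (EuclideanSpace.proj j : EuclideanSpace ℝ (Fin n) →L[ℝ] ℝ).toLinearMap ∘ₗ
      (LinearMap.ker T).subtype
  have hφ : ∀ z, φ z = (z : EuclideanSpace ℝ (Fin n)) j := fun z => rfl
  rw [ae_iff]
  simp only [not_not]
  rcases Set.eq_empty_or_nonempty
    {z : LinearMap.ker T | (p + z : EuclideanSpace ℝ (Fin n)) j = 0} with h | ⟨z₁, hz₁⟩
  · rw [h, measure_empty]
  have hsub : {z : LinearMap.ker T | (p + z : EuclideanSpace ℝ (Fin n)) j = 0} ⊆
      (fun z => z + -z₁) ⁻¹' (LinearMap.ker φ : Set (LinearMap.ker T)) := by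
    intro z hz
    simp only [Set.mem_ofPred_eq, PiLp.add_apply] at hz hz₁
    rw [Set.mem_preimage, SetLike.mem_coe, LinearMap.mem_ker, map_add, map_neg, hφ, hφ]
    linarith
  refine measure_mono_null hsub ?_
  rw [measure_preimage_add_right]
  -- Were the `j`-th coordinate zero on the whole kernel, it would be constant on the translate, yet
  -- it is positive at `z₀` and zero at `z₁`.
  refine Measure.addHaar_submodule ν _ fun htop => ?_
  have h : φ (z₀ - z₁) = 0 := by
    rw [← LinearMap.mem_ker, htop]
    trivial
  have h2 := hz₀ j
  rw [map_sub, hφ, hφ] at h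
  simp only [Set.mem_ofPred_eq, PiLp.add_apply] at h2 hz₁
  linarith

/-- Fibre integrals of the exponential density are continuous at a value whose fibre meets the
open orthant. -/
lemma continuousAt_fiber_integral (hTL : ∀ y, T (L y) = y) {w : Fin n → ℝ} (hw : ∀ j, 0 < w j)
    {u : Fin m → ℝ} (hu : ∀ x : EuclideanSpace ℝ (Fin n), ∑ j, w j * x j = ∑ l, u l * T x l)
    {b : EuclideanSpace ℝ (Fin m)} {z₀ : LinearMap.ker T}
    (hz₀ : ∀ j, 0 < (L b + z₀ : EuclideanSpace ℝ (Fin n)) j)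
    {f : EuclideanSpace ℝ (Fin n) → ℂ} (hf : Continuous f) (hf1 : ∀ x, ‖f x‖ ≤ 1) :
    ContinuousAt (fun y => ∫ z : LinearMap.ker T,
      (expDensity w (L y + z) : ℂ) * f (L y + z) ∂ν) b := by
  have hLc : Continuous L := L.continuous_of_finiteDimensional
  have hW : 0 ≤ ∏ j, w j := Finset.prod_nonneg fun j _ => (hw j).le
  have hTz : ∀ z : LinearMap.ker T, T (z : EuclideanSpace ℝ (Fin n)) = 0 := fun z => z.2
  -- On the fibre over `y`, `∑ w_j x_j = ∑ u_l y_l`, which is below `C` near `b`. This bounds `x = L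
  -- y + z` in the orthant, and `R` then bounds `z`, uniformly in `y`.
  let C : ℝ := ∑ l, u l * b l + 1
  let R : ℝ := Real.sqrt (∑ j, (C / w j) ^ 2) + (‖L b‖ + 1)
  have hC : ∀ᶠ y : EuclideanSpace ℝ (Fin m) in 𝓝 b, ∑ l, u l * y l < C :=
    (show Continuous fun y : EuclideanSpace ℝ (Fin m) => ∑ l, u l * y l by
      fun_prop).continuousAt.eventually (gt_mem_nhds (lt_add_one _))
  have hLb : ∀ᶠ y : EuclideanSpace ℝ (Fin m) in 𝓝 b, ‖L y‖ < ‖L b‖ + 1 :=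
    hLc.norm.continuousAt.eventually (gt_mem_nhds (lt_add_one _))
  refine continuousAt_of_dominated
    (bound := (Metric.closedBall (0 : LinearMap.ker T) R).indicator fun _ => ∏ j, w j) ?_ ?_ ?_ ?_
  · refine Filter.Eventually.of_forall fun y => Measurable.aestronglyMeasurable ?_
    have hm : Measurable fun z : LinearMap.ker T => L y + (z : EuclideanSpace ℝ (Fin n)) := by
      fun_prop
    exact (Complex.measurable_ofReal.comp ((measurable_expDensity w).comp hm)).mul
      (hf.measurable.comp hm)
  · filter_upwards [hC, hLb] with y hyC hyL
    refine ae_of_all _ fun z => ?_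
    by_cases hz : ∀ j, 0 ≤ (L y + z : EuclideanSpace ℝ (Fin n)) j
    · have hle : ‖L y + (z : EuclideanSpace ℝ (Fin n))‖ ≤ Real.sqrt (∑ j, (C / w j) ^ 2) := by
        refine norm_le_of_sum_mul_le hw hz ?_
        rw [hu, map_add, hTL, hTz, add_zero]
        exact hyC.le
      rw [Set.indicator_of_mem]
      · rw [norm_mul, Complex.norm_real, Real.norm_of_nonneg (expDensity_nonneg hw _)]
        exact (mul_le_of_le_one_right (expDensity_nonneg hw _) (hf1 _)).trans (expDensity_le hw _)
      · rw [mem_closedBall_zero_iff]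
        have h1 : ‖(z : EuclideanSpace ℝ (Fin n))‖ ≤ ‖L y + z‖ + ‖L y‖ := by
          simpa using norm_sub_le (L y + (z : EuclideanSpace ℝ (Fin n))) (L y)
        rw [← Submodule.coe_norm] at h1
        simp only [R]
        linarith
    · rw [expDensity_of_not_nonneg w hz]
      simpa using Set.indicator_nonneg (fun _ _ => hW) z
  · exact (integrableOn_const measure_closedBall_lt_top.ne).integrable_indicator
      Metric.isClosed_closedBall.measurableSet
  · filter_upwards [ae_forall_add_apply_ne_zero ν hz₀] with z hz
    have hcont : Continuous fun y => L y + (z : EuclideanSpace ℝ (Fin n)) := by fun_prop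
    refine ContinuousAt.mul ?_ (hf.comp hcont).continuousAt
    exact Complex.continuous_ofReal.continuousAt.comp
      (ContinuousAt.comp (f := fun y => L y + (z : EuclideanSpace ℝ (Fin n)))
        (continuousAt_expDensity w hz) hcont.continuousAt)

end Fiber

open scoped RealInnerProductSpace

/-! ### Hausdorff measure on the polytope as Haar measure on the kernel. -/

section Matrix

variable {m n : ℕ} {A : Matrix (Fin m) (Fin n) ℝ}

lemma toEuclideanLin_apply_apply (A : Matrix (Fin m) (Fin n) ℝ) (x : EuclideanSpace ℝ (Fin n))
    (l : Fin m) : Matrix.toEuclideanLin A x l = ∑ j, A l j * x j := rfl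

lemma mem_polytope_iff {b : Fin m → ℝ} {x : EuclideanSpace ℝ (Fin n)} :
    x ∈ polytope A b ↔ (∀ j, 0 ≤ x j) ∧ Matrix.toEuclideanLin A x = WithLp.toLp 2 b := by
  refine and_congr_right fun _ => ⟨fun h => ?_, fun h l => ?_⟩
  · ext l
    exact h l
  · rw [← toEuclideanLin_apply_apply, h]

lemma finrank_range_toEuclideanLin :
    Module.finrank ℝ (LinearMap.range (Matrix.toEuclideanLin A)) = A.rank := by
  rw [Matrix.rank_eq_finrank_range_toLin A (EuclideanSpace.basisFun (Fin m) ℝ).toBasis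
    (EuclideanSpace.basisFun (Fin n) ℝ).toBasis, Matrix.toEuclideanLin_eq_toLin_orthonormal]

lemma toEuclideanLin_surjective (hrank : A.rank = m) :
    Function.Surjective (Matrix.toEuclideanLin A) := by
  rw [← LinearMap.range_eq_top]
  apply Submodule.eq_top_of_finrank_eq
  rw [finrank_range_toEuclideanLin, hrank, finrank_euclideanSpace_fin]

lemma finrank_ker_toEuclideanLin (hrank : A.rank = m) :
    (Module.finrank ℝ (LinearMap.ker (Matrix.toEuclideanLin A)) : ℝ) = n - m := by
  have h := LinearMap.finrank_range_add_finrank_ker (Matrix.toEuclideanLin A)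
  rw [finrank_range_toEuclideanLin, hrank, finrank_euclideanSpace_fin] at h
  rw [eq_sub_iff_add_eq', ← Nat.cast_add, h]

variable {b : Fin m → ℝ} {L : EuclideanSpace ℝ (Fin m) →ₗ[ℝ] EuclideanSpace ℝ (Fin n)}

/-- The fibre over `b`, parametrized isometrically by the kernel, carries the Hausdorff measure. -/
lemma map_add_hausdorffMeasure (hrank : A.rank = m) (p : EuclideanSpace ℝ (Fin n)) :
    (Measure.hausdorffMeasure (Module.finrank ℝ (LinearMap.ker (Matrix.toEuclideanLin A)) : ℝ) :
        Measure (LinearMap.ker (Matrix.toEuclideanLin A))).map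
        (fun z : LinearMap.ker (Matrix.toEuclideanLin A) => p + (z : EuclideanSpace ℝ (Fin n))) =
      (Measure.hausdorffMeasure ((n : ℝ) - m)).restrict
        (Set.range fun z : LinearMap.ker (Matrix.toEuclideanLin A) =>
          p + (z : EuclideanSpace ℝ (Fin n))) := by
  rw [← finrank_ker_toEuclideanLin hrank]
  refine Isometry.map_hausdorffMeasure (f := fun z : LinearMap.ker (Matrix.toEuclideanLin A) =>
    p + (z : EuclideanSpace ℝ (Fin n))) ?_ (Or.inl (Nat.cast_nonneg _))
  exact (isometry_add_left p).comp isometry_subtype_coe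

lemma polytope_subset_range (hL : ∀ y, Matrix.toEuclideanLin A (L y) = y) :
    polytope A b ⊆ Set.range fun z : LinearMap.ker (Matrix.toEuclideanLin A) =>
      L (WithLp.toLp 2 b) + (z : EuclideanSpace ℝ (Fin n)) := by
  intro x hx
  refine ⟨⟨x - L (WithLp.toLp 2 b), ?_⟩, by simp⟩
  rw [LinearMap.mem_ker, map_sub, hL, (mem_polytope_iff.1 hx).2, sub_self]

lemma add_ker_mem_polytope_iff (hL : ∀ y, Matrix.toEuclideanLin A (L y) = y)
    (z : LinearMap.ker (Matrix.toEuclideanLin A)) :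
    L (WithLp.toLp 2 b) + (z : EuclideanSpace ℝ (Fin n)) ∈ polytope A b ↔
      ∀ j, 0 ≤ (L (WithLp.toLp 2 b) + (z : EuclideanSpace ℝ (Fin n))) j := by
  rw [mem_polytope_iff, map_add, hL, z.2, add_zero]
  simp

lemma measurableEmbedding_add_ker (p : EuclideanSpace ℝ (Fin n)) :
    MeasurableEmbedding fun z : LinearMap.ker (Matrix.toEuclideanLin A) =>
      p + (z : EuclideanSpace ℝ (Fin n)) :=
  (measurableEmbedding_addLeft p).comp
    (MeasurableEmbedding.subtype_coe (Submodule.closed_of_finiteDimensional _).measurableSet)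

lemma setIntegral_polytope (hrank : A.rank = m) (hL : ∀ y, Matrix.toEuclideanLin A (L y) = y)
    (f : EuclideanSpace ℝ (Fin n) → ℂ) :
    ∫ x in polytope A b, f x ∂(Measure.hausdorffMeasure ((n : ℝ) - m)) =
      ∫ z in (fun z : LinearMap.ker (Matrix.toEuclideanLin A) =>
          L (WithLp.toLp 2 b) + (z : EuclideanSpace ℝ (Fin n))) ⁻¹' polytope A b,
        f (L (WithLp.toLp 2 b) + z) ∂(Measure.hausdorffMeasure
          (Module.finrank ℝ (LinearMap.ker (Matrix.toEuclideanLin A)) : ℝ)) := by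
  rw [← (measurableEmbedding_add_ker _).setIntegral_map, map_add_hausdorffMeasure hrank,
    Measure.restrict_restrict_of_subset (polytope_subset_range hL)]

lemma hausdorffMeasure_polytope (hrank : A.rank = m)
    (hL : ∀ y, Matrix.toEuclideanLin A (L y) = y) :
    Measure.hausdorffMeasure ((n : ℝ) - m) (polytope A b) =
      Measure.hausdorffMeasure (Module.finrank ℝ (LinearMap.ker (Matrix.toEuclideanLin A)) : ℝ)
        ((fun z : LinearMap.ker (Matrix.toEuclideanLin A) =>
          L (WithLp.toLp 2 b) + (z : EuclideanSpace ℝ (Fin n))) ⁻¹' polytope A b) := by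
  rw [← (measurableEmbedding_add_ker _).map_apply, map_add_hausdorffMeasure hrank,
    Measure.restrict_eq_self _ (polytope_subset_range hL)]

lemma hausdorffMeasure_polytope_ne_top (hrank : A.rank = m)
    (hcompact : IsCompact (polytope A b)) :
    Measure.hausdorffMeasure ((n : ℝ) - m) (polytope A b) ≠ ⊤ := by
  obtain ⟨L, hL⟩ := (Matrix.toEuclideanLin A).exists_rightInverse_of_surjective
    (LinearMap.range_eq_top.2 (toEuclideanLin_surjective hrank))
  rw [hausdorffMeasure_polytope hrank (L := L) fun y => LinearMap.congr_fun hL y]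
  refine IsCompact.measure_ne_top (Topology.IsClosedEmbedding.isCompact_preimage ?_ hcompact)
  exact ((Homeomorph.addLeft _).isClosedEmbedding).comp
    (Submodule.closed_of_finiteDimensional _).isClosedEmbedding_subtypeVal

/-- The strictly positive points of the fibre form a nonempty relatively open subset of the
polytope. -/
lemma hausdorffMeasure_polytope_ne_zero (hrank : A.rank = m)
    (hpos : ∃ x ∈ polytope A b, ∀ j, 0 < x j) :
    Measure.hausdorffMeasure ((n : ℝ) - m) (polytope A b) ≠ 0 := by
  obtain ⟨L, hL⟩ := (Matrix.toEuclideanLin A).exists_rightInverse_of_surjective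
    (LinearMap.range_eq_top.2 (toEuclideanLin_surjective hrank))
  replace hL : ∀ y, Matrix.toEuclideanLin A (L y) = y := fun y => LinearMap.congr_fun hL y
  rw [hausdorffMeasure_polytope hrank hL]
  obtain ⟨x, hx, hxpos⟩ := hpos
  obtain ⟨z, rfl⟩ := polytope_subset_range hL hx
  have hopen : IsOpen {z : LinearMap.ker (Matrix.toEuclideanLin A) |
      ∀ j, 0 < (L (WithLp.toLp 2 b) + (z : EuclideanSpace ℝ (Fin n))) j} := by
    simp only [Set.ofPred_forall]
    exact isOpen_iInter_of_finite fun j => isOpen_lt continuous_const (by fun_prop)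
  refine ne_bot_of_le_ne_bot (hopen.measure_pos _ ⟨z, hxpos⟩).ne' (measure_mono fun z' hz' => ?_)
  exact (add_ker_mem_polytope_iff hL z').2 fun j => (hz' j).le

/-- This is where the row span condition acts: the exponent equals `-∑ u_l b_l` throughout the
polytope, so the density leaves the integral as a constant. -/
lemma fiber_integral_eq (hrank : A.rank = m) (hcompact : IsCompact (polytope A b))
    (hL : ∀ y, Matrix.toEuclideanLin A (L y) = y) {w : Fin n → ℝ} {u : Fin m → ℝ}
    (hu : ∀ x : EuclideanSpace ℝ (Fin n),
      ∑ j, w j * x j = ∑ l, u l * Matrix.toEuclideanLin A x l)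
    (f : EuclideanSpace ℝ (Fin n) → ℂ) :
    ∫ z : LinearMap.ker (Matrix.toEuclideanLin A),
        (expDensity w (L (WithLp.toLp 2 b) + z) : ℂ) * f (L (WithLp.toLp 2 b) + z)
        ∂(Measure.hausdorffMeasure
          (Module.finrank ℝ (LinearMap.ker (Matrix.toEuclideanLin A)) : ℝ)) =
      (((∏ j, w j) * Real.exp (-∑ l, u l * b l) : ℝ) : ℂ) *
        ∫ x in polytope A b, f x ∂(Measure.hausdorffMeasure ((n : ℝ) - m)) := by
  rw [setIntegral_polytope hrank hL, ← integral_const_mul, ← integral_indicator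
    ((measurableEmbedding_add_ker _).measurable hcompact.measurableSet)]
  refine integral_congr_ae (ae_of_all _ fun z => ?_)
  have hmem : z ∈ (fun z : LinearMap.ker (Matrix.toEuclideanLin A) =>
      L (WithLp.toLp 2 b) + (z : EuclideanSpace ℝ (Fin n))) ⁻¹' polytope A b ↔ _ :=
    add_ker_mem_polytope_iff hL z
  by_cases hz : ∀ j, 0 ≤ (L (WithLp.toLp 2 b) + (z : EuclideanSpace ℝ (Fin n))) j
  · simp only
    rw [Set.indicator_of_mem (hmem.2 hz), expDensity_of_nonneg w hz,
      hu, map_add, hL, z.2, add_zero]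
  · simp only
    rw [Set.indicator_of_notMem (mt hmem.1 hz),
      expDensity_of_not_nonneg w hz, Complex.ofReal_zero, zero_mul]

lemma exists_sum_mul_eq {w : Fin n → ℝ}
    (hspan : w ∈ Submodule.span ℝ (Set.range fun l : Fin m => fun j : Fin n => A l j)) :
    ∃ u : Fin m → ℝ, ∀ x : EuclideanSpace ℝ (Fin n),
      ∑ j, w j * x j = ∑ l, u l * Matrix.toEuclideanLin A x l := by
  obtain ⟨u, rfl⟩ := (Submodule.mem_span_range_iff_exists_fun ℝ).1 hspan
  refine ⟨u, fun x => ?_⟩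
  simp_rw [toEuclideanLin_apply_apply, Finset.mul_sum, Finset.sum_apply, Finset.sum_mul,
    Pi.smul_apply, smul_eq_mul, mul_assoc]
  exact Finset.sum_comm

end Matrix

/-! ### Combining inversion with the fibre integral. -/

variable {m n : ℕ} {A : Matrix (Fin m) (Fin n) ℝ} {b : Fin m → ℝ}

lemma continuous_linStat (c : Fin n → ℝ) : Continuous (linStat A b c) := by
  unfold linStat
  fun_prop

lemma norm_cexp_linStat (c : Fin n → ℝ) (t : ℝ) (x : EuclideanSpace ℝ (Fin n)) :
    ‖Complex.exp (Complex.I * t * (linStat A b c x : ℝ))‖ = 1 := by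
  rw [mul_assoc, ← Complex.ofReal_mul, mul_comm, Complex.norm_exp_ofReal_mul_I]

lemma bartlettIntegrand_eq_fourier {w : Fin n → ℝ} (hw : ∀ j, 0 < w j) (c : Fin n → ℝ) (t : ℝ)
    (η : EuclideanSpace ℝ (Fin m)) :
    bartlettIntegrand A b c w t η =
      ∫ x, ((expDensity w x : ℂ) * Complex.exp (Complex.I * t * (linStat A b c x : ℝ))) *
        Complex.exp (Complex.I *
          (⟪η, Matrix.toEuclideanLin A x - WithLp.toLp 2 b⟫ : ℝ)) := by
  rw [bartlettIntegrand, integral_expLaw hw]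
  refine integral_congr_ae (ae_of_all _ fun x => ?_)
  simp only
  rw [Complex.exp_add, ← mul_assoc]
  congr 4
  simp [PiLp.inner_apply, toEuclideanLin_apply_apply, mul_comm]

/-- The integral of the Bartlett integrand is a constant multiple of the Hausdorff integral over
the polytope. -/
lemma exists_integral_bartlettIntegrand_eq (hrank : A.rank = m)
    (hcompact : IsCompact (polytope A b)) (hpos : ∃ x ∈ polytope A b, ∀ j, 0 < x j)
    (hcol : ∀ j : Fin n,
      (A.submatrix id (fun k : {k : Fin n // k ≠ j} => (k : Fin n))).rank = m)
    {w : Fin n → ℝ} (hw : ∀ j, 0 < w j)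
    (hspan : w ∈ Submodule.span ℝ (Set.range fun l : Fin m => fun j : Fin n => A l j))
    (c : Fin n → ℝ) :
    ∃ K : ℂ, K ≠ 0 ∧ ∀ t : ℝ, ∫ η, bartlettIntegrand A b c w t η =
      K * ∫ x in polytope A b, Complex.exp (Complex.I * t * (linStat A b c x : ℝ))
        ∂(Measure.hausdorffMeasure ((n : ℝ) - m)) := by
  obtain ⟨L, hL⟩ := (Matrix.toEuclideanLin A).exists_rightInverse_of_surjective
    (LinearMap.range_eq_top.2 (toEuclideanLin_surjective hrank))
  replace hL : ∀ y, Matrix.toEuclideanLin A (L y) = y := fun y => LinearMap.congr_fun hL y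
  obtain ⟨u, hu⟩ := exists_sum_mul_eq hspan
  obtain ⟨x₀, hx₀, hx₀pos⟩ := hpos
  obtain ⟨z₀, rfl⟩ := polytope_subset_range hL hx₀
  obtain ⟨K, hK, hinv⟩ := exists_integral_fourier_eq_fiber_integral hL volume
    (Measure.hausdorffMeasure (Module.finrank ℝ (LinearMap.ker (Matrix.toEuclideanLin A)) : ℝ))
  refine ⟨K * (((∏ j, w j) * Real.exp (-∑ l, u l * b l) : ℝ) : ℂ), mul_ne_zero hK ?_,
    fun t => ?_⟩
  · exact_mod_cast (mul_pos (Finset.prod_pos fun j _ => hw j) (Real.exp_pos _)).ne'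
  have hf : Continuous fun x => Complex.exp (Complex.I * t * (linStat A b c x : ℝ)) := by
    have := continuous_linStat (A := A) (b := b) c
    fun_prop
  have hf1 := fun x => (norm_cexp_linStat (A := A) (b := b) c t x).le
  have hint := integrable_bartlettIntegrand b hrank hcol hw c t
  have hB := funext fun η => bartlettIntegrand_eq_fourier (A := A) (b := b) hw c t η
  rw [hB] at hint ⊢
  rw [hinv (WithLp.toLp 2 b) _ (integrable_expDensity_mul hw hf hf1)
    (continuousAt_fiber_integral _ hL hw hu hx₀pos hf hf1) hint,
    fiber_integral_eq hrank hcompact hL hu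
      fun x => Complex.exp (Complex.I * t * (linStat A b c x : ℝ)), mul_assoc]

end PolytopeBartlett

end


theorem corollary5p3 {m n : ℕ} (A : Matrix (Fin m) (Fin n) ℝ) (b : Fin m → ℝ)
    (hrank : A.rank = m)
    (hcompact : IsCompact (PolytopeBartlett.polytope A b))
    (hpos : ∃ x ∈ PolytopeBartlett.polytope A b, ∀ j, 0 < x j)
    (hcol : ∀ j : Fin n,
      (A.submatrix id (fun k : {k : Fin n // k ≠ j} => (k : Fin n))).rank = A.rank)
    (w : Fin n → ℝ) (hw : ∀ j, 0 < w j)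
    (hspan : w ∈ Submodule.span ℝ (Set.range fun l : Fin m => fun j : Fin n => A l j))
    (c : Fin n → ℝ) :
    (iIndepFun (fun (j : Fin n) (x : EuclideanSpace ℝ (Fin n)) => x j)
        (PolytopeBartlett.expLaw w) ∧
      ∀ j : Fin n, (PolytopeBartlett.expLaw w).map
        (fun x : EuclideanSpace ℝ (Fin n) => x j) = expMeasure (w j)) ∧
    (∀ t : ℝ, Integrable (PolytopeBartlett.bartlettIntegrand A b c w t) volume) ∧
    (∫ η, PolytopeBartlett.bartlettIntegrand A b c w 0 η) ≠ 0 ∧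
    ∀ t : ℝ,
      ∫ x, Complex.exp (Complex.I * t * (PolytopeBartlett.linStat A b c x : ℝ))
          ∂(PolytopeBartlett.uniformLaw A b) =
        (∫ η, PolytopeBartlett.bartlettIntegrand A b c w t η) /
          ∫ η, PolytopeBartlett.bartlettIntegrand A b c w 0 η := by
  have hcol' := fun j => (hcol j).trans hrank
  obtain ⟨K, hK, hKt⟩ := PolytopeBartlett.exists_integral_bartlettIntegrand_eq hrank hcompact hpos
    hcol' hw hspan c
  set M := Measure.hausdorffMeasure ((n : ℝ) - m) (PolytopeBartlett.polytope A b) with hM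
  have hM0 : M.toReal ≠ 0 := ENNReal.toReal_ne_zero.2
    ⟨PolytopeBartlett.hausdorffMeasure_polytope_ne_zero hrank hpos,
      PolytopeBartlett.hausdorffMeasure_polytope_ne_top hrank hcompact⟩
  have hM0' : (M.toReal : ℂ) ≠ 0 := by exact_mod_cast hM0
  -- At `t = 0` the integrand on the polytope is `1`, so the denominator is `K` times the Hausdorff
  -- measure, which is the normalization of the uniform law.
  have h0 : ∫ η, PolytopeBartlett.bartlettIntegrand A b c w 0 η = K * M.toReal := by
    rw [hKt]
    simp [Measure.real, hM]
  refine ⟨⟨PolytopeBartlett.iIndepFun_expLaw hw, PolytopeBartlett.map_eval_expLaw hw⟩,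
    PolytopeBartlett.integrable_bartlettIntegrand b hrank hcol' hw c, ?_, fun t => ?_⟩
  · rw [h0]
    exact mul_ne_zero hK hM0'
  · rw [h0, hKt, PolytopeBartlett.uniformLaw, integral_smul_measure, ENNReal.toReal_inv,
      Complex.real_smul, ← hM, mul_div_mul_left _ _ hK]
    push_cast
    rw [div_eq_inv_mul]
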